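/- **Notation.** Let $\Phi_0=\mathbf 1_{[0,1)}$ and $\Phi_p(s)=\frac sp\Phi_{p-1}(s)+\frac{p+1-s}{p}\Phi_{p-1}(s-1)$, $p\ge1$, be the cardinal B-splines. Given $T>0$, $N\ge 1$, $p\ge 1$, let $h=T/N$, let $\varphi^p_0,\dots,\varphi^p_{N+p-1}$ be the B-splines of degree $p$ on $[0,T]$ given by the Cox–de Boor recursion on the open knot vector $\xi_0=\dots=\xi_p=0$, $\xi_{p+\ell}=\ell h$ $(1\le \ell\le N-1)$, $\xi_{p+N}=\dots=\xi_{2p+N}=T$, and define the $n\times n$ matrices, $n=N+p-1$, $$\mathbf M[\ell,j]=\int_0^T\varphi^p_j\,\varphi^p_{\ell-1}\,dt,\qquad \mathbf B[\ell,j]=\int_0^T\partial_t\varphi^p_j\,\partial_t\varphi^p_{\ell-1}\,dt,\qquad \mathbf D[\ell,j]=\int_0^T\partial_t^p\varphi^p_j\,\partial_t^p\varphi^p_{\ell-1}\,dt .$$ For $\rho,\delta\in\mathbb R$ put $\mu=\rho/h^2$ and $\mathbf K^p_n(\rho,\delta)=h\,(-\mathbf B+\mu\mathbf M+\mu\delta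 h^{2p}\mathbf D)$. In the central rows $2p+1\le\ell\le N-p$ these matrices have a Toeplitz band form, $\mathbf K^p_n(\rho,\delta)[\ell,j]=c_{j-\ell}$, with $c_r=0$ unless $-(p+1)\le r\le p-1$, where $c_r$ depends only on $p,\rho,\delta,r$; the associated polynomial is $q^{\mathbf K^p(\rho,\delta)}(z)=\sum_{r=-(p+1)}^{p-1}c_r z^{p+1+r}$. It is given by $$q^{\mathbf K^p(\rho,\delta)}(z)=k_p z^p+\sum_{j=1}^p k_{p-j}\,(z^{p-j}+z^{p+j}),$$ $$k_{p-j}=\partial_s^2\Phi_{2p+1}(p+1-j)+\rho\bigl(\Phi_{2p+1}(p+1-j)+\delta(-1)^p\partial_s^{2p}\Phi_{2p+1}(p+1-j)\bigr),\qquad 0\le j\le p.$$ **Proposition.** Let $p\ge1$ and, for $\theta\in[-\pi,\pi]\setminus\{0\}$, let $$M_p(\theta)=(2-2\cos\theta)^{p+1}\sum_{j\in\mathbb Z}\frac1{(\theta+2j\pi)^{2p+2}},\qquad B_p(\theta)=-(2-2\cos\theta)^{p+1}\sum_{j\in\mathbb Z}\frac1{(\theta+2j\pi)^{2p}}.$$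 The series converge, and $M_p,B_p$ extend continuously to $[-\pi,\pi]$ with $M_p(0)=1$, $B_p(0)=0$. Let $D_p(\theta)=(-1)^p(2-2\cos\theta)^p$. Then for all $\theta\in[-\pi,\pi]$ $$\Phi_{2p+1}(p+1)+\sum_{j=1}^p\Phi_{2p+1}(p+1-j)\,(e^{-\mathrm i j\theta}+e^{\mathrm i j\theta})=M_p(\theta),$$ $$\partial_s^2\Phi_{2p+1}(p+1)+\sum_{j=1}^p\partial_s^2\Phi_{2p+1}(p+1-j)\,(e^{-\mathrm i j\theta}+e^{\mathrm i j\theta})=B_p(\theta),$$ $$\partial_s^{2p}\Phi_{2p+1}(p+1)+\sum_{j=1}^p\partial_s^{2p}\Phi_{2p+1}(p+1-j)\,(e^{-\mathrm i j\theta}+e^{\mathrm i j\theta})=D_p(\theta).$$ Moreover, for all $\rho,\delta\in\mathbb R$, the polynomial associated with the Toeplitz band parts of the matrices $\mathbf K^p_n(\rho,\delta)$ is the $q^{\mathbf K^p(\rho,\delta)}$ displayed above, and for all $\theta\in[-\pi,\pi]$ $$q^{\mathbf K^p(\rho,\delta)}(e^{\mathrm i\theta})=e^{\mathrm i p\theta}\bigl(B_p(\theta)+\rho\,(M_p(\theta)+\delta(-1)^pD_p(\theta))\bigr).$$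 -/

import Mathlib

noncomputable section

open Polynomial

namespace SplineSymbol

/-- The cardinal B-spline of degree `p` over the knots `0, …, p + 1`. -/
def cardinalBSpline : ℕ → ℝ → ℝ
  | 0, s => if 0 ≤ s ∧ s < 1 then 1 else 0
  | p + 1, s =>
      s / ((p : ℝ) + 1) * cardinalBSpline p s
        + ((p : ℝ) + 2 - s) / ((p : ℝ) + 1) * cardinalBSpline p (s - 1)

/-- The uniform mesh size of `[0, T]` with `N` elements. -/
def meshSize (T : ℝ) (N : ℕ) : ℝ := T / N

/-- The open knot vector of maximal regularity: `ξ_0 = … = ξ_p = 0`, `ξ_{p+ℓ} = ℓ h` for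
`1 ≤ ℓ ≤ N - 1`, and `ξ_{p+N} = … = ξ_{2p+N} = T`. Subtraction is truncated in `ℕ`. -/
def knot (T : ℝ) (N p : ℕ) (j : ℕ) : ℝ := meshSize T N * ((min (j - p) N : ℕ) : ℝ)

/-- Cox–de Boor recursion for the B-spline of degree `k` with index `j` on the knots `ξ`.
The usual convention that quotients with denominator `0` vanish is in force. -/
def bspline (ξ : ℕ → ℝ) : ℕ → ℕ → ℝ → ℝ
  | 0, j, t => if ξ j ≤ t ∧ t < ξ (j + 1) then 1 else 0
  | k + 1, j, t =>
      if ξ j ≤ t ∧ t < ξ (j + k + 2) then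
        (t - ξ j) / (ξ (j + k + 1) - ξ j) * bspline ξ k j t
          + (ξ (j + k + 2) - t) / (ξ (j + k + 2) - ξ (j + 1)) * bspline ξ k (j + 1) t
      else 0

/-- The spline basis function `φ_j^p`, `0 ≤ j ≤ N + p - 1`. -/
def splineBasis (T : ℝ) (N p j : ℕ) : ℝ → ℝ := bspline (knot T N p) p j

/-- The matrix with entries `∫_0^T ∂^k φ_j^p ∂^k φ_{ℓ-1}^p` for `1 ≤ ℓ, j ≤ N + p - 1`. The Lean
indices start at `0`, so the row `i` is `ℓ = i + 1` and the column `j` stands for `j + 1`. -/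
def galerkinMatrix (T : ℝ) (N p k : ℕ) : Matrix (Fin (N + p - 1)) (Fin (N + p - 1)) ℝ :=
  fun i j => ∫ t in (0 : ℝ)..T,
    iteratedDeriv k (splineBasis T N p ((j : ℕ) + 1)) t
      * iteratedDeriv k (splineBasis T N p (i : ℕ)) t

/-- Mass matrix. -/
def massMatrix (T : ℝ) (N p : ℕ) : Matrix (Fin (N + p - 1)) (Fin (N + p - 1)) ℝ :=
  galerkinMatrix T N p 0

/-- Stiffness matrix. -/
def stiffnessMatrix (T : ℝ) (N p : ℕ) : Matrix (Fin (N + p - 1)) (Fin (N + p - 1)) ℝ :=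
  galerkinMatrix T N p 1

/-- Matrix of the derivatives of order `p`. -/
def penaltyMatrix (T : ℝ) (N p : ℕ) : Matrix (Fin (N + p - 1)) (Fin (N + p - 1)) ℝ :=
  galerkinMatrix T N p p

/-- The system matrix `-B + μ M + μ δ h^{2p} D` of the stabilized bilinear form. -/
def systemMatrix (T : ℝ) (N p : ℕ) (μ δ : ℝ) :
    Matrix (Fin (N + p - 1)) (Fin (N + p - 1)) ℝ :=
  -stiffnessMatrix T N p + μ • massMatrix T N p
    + (μ * δ * meshSize T N ^ (2 * p)) • penaltyMatrix T N p

/-- The scaled system matrix `K_n^p(ρ, δ)`, `n = N + p - 1`: `h` times the system matrix whose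
parameter `μ` is determined by `ρ = μ h²`. -/
def scaledSystemMatrix (T : ℝ) (N p : ℕ) (ρ δ : ℝ) :
    Matrix (Fin (N + p - 1)) (Fin (N + p - 1)) ℝ :=
  meshSize T N • systemMatrix T N p (ρ / meshSize T N ^ 2) δ

/-- `q` is the polynomial associated with the Toeplitz band part of the family `A`, of lower
bandwidth `p + 1` and upper bandwidth `p - 1`: in the central rows `ℓ = 2p + 1, …, N - p` (that is,
`2p ≤ i` and `i + p + 1 ≤ N` for `ℓ = i + 1`) the entry in position `(i, j)` is `c_{j-i}`, where
`q = ∑ c_r z^{p+1+r}` over `-(p + 1) ≤ r ≤ p - 1`, and `c_r = 0` for all other `r`. -/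
def IsAssociatedPolynomial (p : ℕ)
    (A : ∀ N : ℕ, Matrix (Fin (N + p - 1)) (Fin (N + p - 1)) ℝ) (q : ℝ[X]) : Prop :=
  q.natDegree ≤ 2 * p ∧
    ∀ (N : ℕ) (i j : Fin (N + p - 1)), 2 * p ≤ (i : ℕ) → (i : ℕ) + p + 1 ≤ N →
      A N i j = if (i : ℕ) ≤ (j : ℕ) + p + 1 then q.coeff ((j : ℕ) + p + 1 - (i : ℕ)) else 0

/-- The coefficient `k_i^p(ρ, δ)`, `0 ≤ i ≤ p`. With `i = p - j` the splines are evaluated at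
`p + 1 - j = i + 1`. -/
def kCoeff (p : ℕ) (ρ δ : ℝ) (i : ℕ) : ℝ :=
  iteratedDeriv 2 (cardinalBSpline (2 * p + 1)) ((i : ℝ) + 1)
    + ρ * (cardinalBSpline (2 * p + 1) ((i : ℝ) + 1)
      + δ * (-1) ^ p * iteratedDeriv (2 * p) (cardinalBSpline (2 * p + 1)) ((i : ℝ) + 1))

/-- `k_0 + k_1 z + … + k_p z^p + … + k_1 z^{2p-1} + k_0 z^{2p}`. -/
def qPoly (p : ℕ) (ρ δ : ℝ) : ℝ[X] :=
  C (kCoeff p ρ δ p) * X ^ p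
    + ∑ j ∈ Finset.Icc 1 p, C (kCoeff p ρ δ (p - j)) * (X ^ (p - j) + X ^ (p + j))

/-- `M_p(θ) = (2 - 2 cos θ)^{p+1} ∑_{j ∈ ℤ} (θ + 2jπ)^{-2p-2}` on `[-π, π]`; at `θ = 0`, where the
formula is the indeterminate `0 · ∞`, its limit `1`. -/
def symbolM (p : ℕ) (θ : ℝ) : ℝ :=
  if θ = 0 then 1
  else (2 - 2 * Real.cos θ) ^ (p + 1) * ∑' j : ℤ, 1 / (θ + 2 * j * Real.pi) ^ (2 * p + 2)

/-- `B_p(θ) = -(2 - 2 cos θ)^{p+1} ∑_{j ∈ ℤ} (θ + 2jπ)^{-2p}` on `[-π, π]`; at `θ = 0` its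
limit `0`. -/
def symbolB (p : ℕ) (θ : ℝ) : ℝ :=
  if θ = 0 then 0
  else -(2 - 2 * Real.cos θ) ^ (p + 1) * ∑' j : ℤ, 1 / (θ + 2 * j * Real.pi) ^ (2 * p)

/-- `D_p(θ) = (-1)^p (2 - 2 cos θ)^p`. -/
def symbolD (p : ℕ) (θ : ℝ) : ℝ := (-1) ^ p * (2 - 2 * Real.cos θ) ^ p

/-- The sum `∂^k Φ_{2p+1}(p+1) + ∑_{j=1}^p ∂^k Φ_{2p+1}(p+1-j) (e^{-ijθ} + e^{ijθ})`. -/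
def splineSum (p k : ℕ) (θ : ℝ) : ℂ :=
  ((iteratedDeriv k (cardinalBSpline (2 * p + 1)) ((p : ℝ) + 1) : ℝ) : ℂ)
    + ∑ j ∈ Finset.Icc 1 p,
        ((iteratedDeriv k (cardinalBSpline (2 * p + 1)) ((p : ℝ) + 1 - j) : ℝ) : ℂ)
          * (Complex.exp (-(Complex.I * j * θ)) + Complex.exp (Complex.I * j * θ))

end SplineSymbol

end

namespace SplineSymbol

open MeasureTheory Set Filter Topology FourierTransform Polynomial

/-! Put `z = exp (iθ)`. By symmetry and compact support, `z ^ (p + 1) * splineSum p k θ` for even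
`k` is the full generating function `∑ ∂^k Φ_{2p+1}(n) z ^ n` over `n ∈ ℤ`. Since `Φ_m' = Φ_{m-1} -
Φ_{m-1}(· - 1)`, it equals `(1 - z) ^ k * ∑ Φ_{2p+1-k}(n) z ^ n` (`exp_pow_mul_splineSum`). The
Fourier transform of `Φ_m` is a power of that of the unit box, so Poisson summation turns the
remaining sum into `∑ 1 / (θ + 2jπ) ^ (2r+2)` in degree `2r + 1` (`tsum_cardinalBSpline_odd`).
Together with `(1 - z) ^ 2 = -(2 - 2 cos θ) z`, the choices `k = 0, 2` give `M_p` and `B_p`; for `k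
= 2p` only the hat function is left, which gives `D_p`. In the central rows all overlapping basis
functions are dilated translates of `Φ_p`. Their integrals are correlations, and `Φ_a * Φ_b =
Φ_{a+b+1}` together with symmetry evaluates these as values of `∂^{2k} Φ_{2p+1}` at integers
(`integral_iteratedDeriv_cardinalBSpline_mul`). -/

/-! ### Support, boundedness and continuity of the cardinal B-splines. -/

theorem cardinalBSpline_zero_apply (s : ℝ) :
    cardinalBSpline 0 s = if 0 ≤ s ∧ s < 1 then 1 else 0 := rfl

theorem cardinalBSpline_succ_apply (m : ℕ) (s : ℝ) :
    cardinalBSpline (m + 1) s = s / ((m : ℝ) + 1) * cardinalBSpline m s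
      + ((m : ℝ) + 2 - s) / ((m : ℝ) + 1) * cardinalBSpline m (s - 1) := rfl

theorem cardinalBSpline_of_neg (m : ℕ) {s : ℝ} (hs : s < 0) : cardinalBSpline m s = 0 := by
  induction m generalizing s with
  | zero => rw [cardinalBSpline_zero_apply, if_neg fun h => hs.not_ge h.1]
  | succ m ih => rw [cardinalBSpline_succ_apply, ih hs, ih (by linarith)]; simp

theorem cardinalBSpline_of_ge (m : ℕ) {s : ℝ} (hs : (m : ℝ) + 1 ≤ s) :
    cardinalBSpline m s = 0 := by
  induction m generalizing s with
  | zero =>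
    rw [cardinalBSpline_zero_apply, if_neg fun h => ?_]
    push_cast at hs
    linarith [h.2]
  | succ m ih =>
    push_cast at hs
    rw [cardinalBSpline_succ_apply, ih (by linarith), ih (by linarith)]; simp

theorem cardinalBSpline_succ_zero (m : ℕ) : cardinalBSpline (m + 1) 0 = 0 := by
  rw [cardinalBSpline_succ_apply, cardinalBSpline_of_neg m (s := 0 - 1) (by norm_num)]
  simp

theorem measurable_cardinalBSpline (m : ℕ) : Measurable (cardinalBSpline m) := by
  induction m with
  | zero =>
    exact Measurable.ite (measurableSet_Ici.inter measurableSet_Iio) measurable_const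
      measurable_const
  | succ m ih =>
    have h := ih.comp (measurable_id.sub_const (1 : ℝ))
    exact ((measurable_id.div_const _).mul ih).add
      (((measurable_const.sub measurable_id).div_const _).mul h)

theorem exists_abs_cardinalBSpline_le (m : ℕ) : ∃ c : ℝ, ∀ s, |cardinalBSpline m s| ≤ c := by
  induction m with
  | zero =>
    refine ⟨1, fun s => ?_⟩
    rw [cardinalBSpline_zero_apply]
    split_ifs <;> simp
  | succ m ih =>
    obtain ⟨c, hc⟩ := ih
    have hc0 : 0 ≤ c := (abs_nonneg _).trans (hc 0)
    refine ⟨((m : ℝ) + 2) * c + ((m : ℝ) + 2) * c, fun s => ?_⟩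
    rcases lt_or_ge s 0 with hs | hs
    · rw [cardinalBSpline_of_neg _ hs, abs_zero]; positivity
    rcases le_or_gt ((m + 1 : ℕ) + 1 : ℝ) s with hs' | hs'
    · rw [cardinalBSpline_of_ge _ hs', abs_zero]; positivity
    push_cast at hs'
    have key : ∀ a : ℝ, 0 ≤ a → a ≤ m + 2 → |a / ((m : ℝ) + 1)| ≤ m + 2 := fun a h0 h1 => by
      rw [abs_of_nonneg (by positivity)]
      exact (div_le_self h0 (by linarith [m.cast_nonneg (α := ℝ)])).trans h1
    rw [cardinalBSpline_succ_apply]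
    refine (abs_add_le _ _).trans ?_
    rw [abs_mul, abs_mul]
    exact add_le_add
      (mul_le_mul (key _ hs (by linarith)) (hc _) (abs_nonneg _) (by positivity))
      (mul_le_mul (key _ (by linarith) (by linarith)) (hc _) (abs_nonneg _) (by positivity))

theorem support_cardinalBSpline_subset (m : ℕ) :
    Function.support (cardinalBSpline m) ⊆ Icc 0 ((m : ℝ) + 1) := by
  intro s hs
  by_contra h
  rw [mem_Icc, not_and_or, not_le, not_le] at h
  exact hs (h.elim (cardinalBSpline_of_neg m) fun h => cardinalBSpline_of_ge m h.le)

theorem integrable_cardinalBSpline (m : ℕ) : Integrable (cardinalBSpline m) := by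
  rw [← integrableOn_iff_integrable_of_support_subset (support_cardinalBSpline_subset m)]
  obtain ⟨c, hc⟩ := exists_abs_cardinalBSpline_le m
  exact Measure.integrableOn_of_bounded (M := c) (by simp)
    (measurable_cardinalBSpline m).aestronglyMeasurable (ae_of_all _ hc)

/-- The recursion preserves continuity but starts from a jump function; the closed form in degree
one supplies the continuous base case. -/
theorem cardinalBSpline_one_apply (s : ℝ) :
    cardinalBSpline 1 s = max 0 (min s (2 - s)) := by
  rw [cardinalBSpline_succ_apply, cardinalBSpline_zero_apply, cardinalBSpline_zero_apply]
  norm_num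
  split_ifs <;> grind

theorem continuous_cardinalBSpline_succ (m : ℕ) : Continuous (cardinalBSpline (m + 1)) := by
  induction m with
  | zero =>
    rw [funext cardinalBSpline_one_apply]
    fun_prop
  | succ m ih =>
    rw [funext (cardinalBSpline_succ_apply (m + 1))]
    fun_prop

/-! ### Derivatives as backward differences. -/

/-- The backward difference `f s - f (s - 1)`. -/
def backwardDiff (f : ℝ → ℝ) : ℝ → ℝ := fun s => f s - f (s - 1)

/-- The set `S` is kept general to cover both the whole line and the complement of the integers,
where the low degrees are differentiable. -/
theorem hasDerivAt_backwardDiff_iterate {f g : ℝ → ℝ} {S : Set ℝ} (hS : ∀ s ∈ S, s - 1 ∈ S)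
    (h : ∀ s ∈ S, HasDerivAt f (g s) s) (k : ℕ) :
    ∀ s ∈ S, HasDerivAt (backwardDiff^[k] f) (backwardDiff^[k] g s) s := by
  induction k with
  | zero => exact h
  | succ k ih =>
    intro s hs
    rw [Function.iterate_succ_apply', Function.iterate_succ_apply']
    exact (ih s hs).sub ((ih _ (hS s hs)).comp_sub_const s 1)

theorem sub_one_notMem_range_intCast (s : ℝ) (hs : s ∈ (range ((↑) : ℤ → ℝ))ᶜ) :
    s - 1 ∈ (range ((↑) : ℤ → ℝ))ᶜ := by
  rintro ⟨n, hn⟩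
  exact hs ⟨n + 1, by push_cast; linarith⟩

theorem hasDerivAt_cardinalBSpline_zero {s : ℝ} (hs : s ∈ (range ((↑) : ℤ → ℝ))ᶜ) :
    HasDerivAt (cardinalBSpline 0) 0 s := by
  have h0 : s ≠ 0 := fun h => hs ⟨0, by simp [h]⟩
  have h1 : s ≠ 1 := fun h => hs ⟨1, by simp [h]⟩
  refine (hasDerivAt_const s (cardinalBSpline 0 s)).congr_of_eventuallyEq ?_
  rcases h0.lt_or_gt with h0 | h0
  · filter_upwards [Iio_mem_nhds h0] with t ht
    rw [cardinalBSpline_of_neg 0 h0, cardinalBSpline_of_neg 0 ht]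
  rcases h1.lt_or_gt with h1 | h1
  · filter_upwards [Ioo_mem_nhds h0 h1] with t ht
    rw [cardinalBSpline_zero_apply, cardinalBSpline_zero_apply, if_pos ⟨ht.1.le, ht.2⟩,
      if_pos ⟨h0.le, h1⟩]
  · filter_upwards [Ioi_mem_nhds h1] with t ht
    rw [cardinalBSpline_of_ge 0 (by simpa using le_of_lt ht),
      cardinalBSpline_of_ge 0 (by simpa using h1.le)]

theorem hasDerivAt_cardinalBSpline_succ_of_notMem (m : ℕ) :
    ∀ s ∈ (range ((↑) : ℤ → ℝ))ᶜ,
      HasDerivAt (cardinalBSpline (m + 1)) (backwardDiff (cardinalBSpline m) s) s := by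
  have step : ∀ (m : ℕ) (s a b : ℝ), HasDerivAt (cardinalBSpline m) a s →
      HasDerivAt (cardinalBSpline m) b (s - 1) →
      HasDerivAt (cardinalBSpline (m + 1))
        (1 / ((m : ℝ) + 1) * cardinalBSpline m s + s / ((m : ℝ) + 1) * a
          + (-1 / ((m : ℝ) + 1) * cardinalBSpline m (s - 1)
            + ((m : ℝ) + 2 - s) / ((m : ℝ) + 1) * b)) s := by
    intro m s a b ha hb
    exact (((hasDerivAt_id s).div_const _).mul ha).add
      ((((hasDerivAt_id s).const_sub _).div_const _).mul (hb.comp_sub_const s 1))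
  induction m with
  | zero =>
    intro s hs
    refine (step 0 s 0 0 (hasDerivAt_cardinalBSpline_zero hs)
      (hasDerivAt_cardinalBSpline_zero (sub_one_notMem_range_intCast s hs))).congr_deriv ?_
    simp only [backwardDiff]
    norm_num
    ring
  | succ m ih =>
    intro s hs
    refine (step (m + 1) s _ _ (ih s hs)
      (ih _ (sub_one_notMem_range_intCast s hs))).congr_deriv ?_
    simp only [backwardDiff, cardinalBSpline_succ_apply]
    have h1 : (m : ℝ) + 1 ≠ 0 := by positivity
    have h2 : (m : ℝ) + 1 + 1 ≠ 0 := by positivity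
    push_cast
    field_simp
    ring

/-- The fundamental theorem of calculus tolerates a countable exceptional set for a continuous
primitive, so the knots do no harm. -/
theorem integral_backwardDiff_cardinalBSpline (m : ℕ) (x : ℝ) :
    ∫ t in (0 : ℝ)..x, backwardDiff (cardinalBSpline m) t = cardinalBSpline (m + 1) x := by
  rw [integral_eq_of_hasDerivAt_off_countable (cardinalBSpline (m + 1)) _
    (countable_range ((↑) : ℤ → ℝ)) (continuous_cardinalBSpline_succ m).continuousOn
    (fun s hs => hasDerivAt_cardinalBSpline_succ_of_notMem m s hs.2),
    cardinalBSpline_succ_zero, sub_zero]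
  exact ((integrable_cardinalBSpline m).sub
    ((integrable_cardinalBSpline m).comp_sub_right 1)).intervalIntegrable

/-- From degree two on the integrand in `integral_backwardDiff_cardinalBSpline` is continuous, so
differentiating the integral gives the derivative at the knots as well. -/
theorem hasDerivAt_cardinalBSpline_add_two (m : ℕ) (s : ℝ) :
    HasDerivAt (cardinalBSpline (m + 2)) (backwardDiff (cardinalBSpline (m + 1)) s) s := by
  have hc : Continuous (backwardDiff (cardinalBSpline (m + 1))) :=
    (continuous_cardinalBSpline_succ m).sub
      ((continuous_cardinalBSpline_succ m).comp (continuous_sub_right 1))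
  have h := (hc.integral_hasStrictDerivAt 0 s).hasDerivAt
  rwa [funext (integral_backwardDiff_cardinalBSpline (m + 1))] at h

theorem cardinalBSpline_succ_eq_integral (m : ℕ) (x : ℝ) :
    cardinalBSpline (m + 1) x = ∫ u in (0 : ℝ)..1, cardinalBSpline m (x - u) := by
  have hi : ∀ a b, IntervalIntegrable (cardinalBSpline m) volume a b := fun a b =>
    (integrable_cardinalBSpline m).intervalIntegrable
  have h0 : ∫ t in (-1 : ℝ)..0, cardinalBSpline m t = 0 := by
    rw [intervalIntegral.integral_of_le (by norm_num), integral_Ioc_eq_integral_Ioo]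
    exact setIntegral_eq_zero_of_forall_eq_zero fun t ht => cardinalBSpline_of_neg m ht.2
  rw [← integral_backwardDiff_cardinalBSpline,
    intervalIntegral.integral_comp_sub_left (cardinalBSpline m)]
  simp only [backwardDiff]
  rw [intervalIntegral.integral_sub (hi _ _)
    ((integrable_cardinalBSpline m).comp_sub_right 1).intervalIntegrable,
    intervalIntegral.integral_comp_sub_right (cardinalBSpline m)]
  have h1 := intervalIntegral.integral_add_adjacent_intervals (hi (-1) 0) (hi 0 x)
  have h2 := intervalIntegral.integral_add_adjacent_intervals (hi (-1) (x - 1)) (hi (x - 1) x)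
  simp only [sub_zero, zero_sub]
  linarith

theorem iteratedDeriv_cardinalBSpline (k m : ℕ) :
    iteratedDeriv k (cardinalBSpline (m + 1 + k)) = backwardDiff^[k] (cardinalBSpline (m + 1)) := by
  induction k generalizing m with
  | zero => simp
  | succ k ih =>
    rw [iteratedDeriv_succ, show m + 1 + (k + 1) = m + 1 + 1 + k by ring, ih (m + 1),
      Function.iterate_succ_apply]
    ext s
    exact (hasDerivAt_backwardDiff_iterate (S := univ) (fun _ _ => mem_univ _)
      (fun s _ => hasDerivAt_cardinalBSpline_add_two m s) k s (mem_univ s)).deriv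

/-- The gain over `iteratedDeriv_cardinalBSpline` is the case `m = 0`, needed for the derivative of
order `p` in degree `p`; the last differentiation then acts on differences of the hat function. -/
theorem iteratedDeriv_cardinalBSpline_of_notMem (k m : ℕ) {s : ℝ}
    (hs : s ∈ (range ((↑) : ℤ → ℝ))ᶜ) :
    iteratedDeriv k (cardinalBSpline (m + k)) s = backwardDiff^[k] (cardinalBSpline m) s := by
  rcases m with _ | m
  · rcases k with _ | k
    · simp
    rw [iteratedDeriv_succ, show 0 + (k + 1) = 0 + 1 + k by ring, iteratedDeriv_cardinalBSpline,
      Function.iterate_succ_apply]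
    exact (hasDerivAt_backwardDiff_iterate sub_one_notMem_range_intCast
      (hasDerivAt_cardinalBSpline_succ_of_notMem 0) k s hs).deriv
  · rw [iteratedDeriv_cardinalBSpline]

/-! ### Symmetry. -/

/-- In degree zero the half-open box breaks the symmetry at its endpoints, so the induction avoids
the integers; continuity restores them in positive degree. -/
theorem cardinalBSpline_sub_self_of_notMem (m : ℕ) {s : ℝ} (hs : s ∈ (range ((↑) : ℤ → ℝ))ᶜ) :
    cardinalBSpline m ((m : ℝ) + 1 - s) = cardinalBSpline m s := by
  induction m generalizing s with
  | zero =>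
    have h0 : s ≠ 0 := fun h => hs ⟨0, by simp [h]⟩
    have h1 : s ≠ 1 := fun h => hs ⟨1, by simp [h]⟩
    rw [cardinalBSpline_zero_apply, cardinalBSpline_zero_apply]
    norm_num
    grind
  | succ m ih =>
    have e1 := ih hs
    have e2 := ih (sub_one_notMem_range_intCast s hs)
    rw [cardinalBSpline_succ_apply, cardinalBSpline_succ_apply, ← e1, ← e2]
    push_cast
    rw [show (m : ℝ) + 1 + 1 - s - 1 = m + 1 - s by ring,
      show (m : ℝ) + 1 - (s - 1) = m + 1 + 1 - s by ring]
    ring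

/-- The cardinal B-splines of positive degree are symmetric. -/
theorem cardinalBSpline_succ_sub_self (m : ℕ) (s : ℝ) :
    cardinalBSpline (m + 1) ((m : ℝ) + 2 - s) = cardinalBSpline (m + 1) s := by
  have hd : Dense (range ((↑) : ℤ → ℝ))ᶜ := (countable_range _).dense_compl ℝ
  have h := Continuous.ext_on hd
    ((continuous_cardinalBSpline_succ m).comp (continuous_sub_left ((m : ℝ) + 2)))
    (continuous_cardinalBSpline_succ m) fun s hs => by
      have := cardinalBSpline_sub_self_of_notMem (m + 1) hs
      push_cast at this
      rwa [show (m : ℝ) + 1 + 1 - s = m + 2 - s by ring] at this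
  exact congrFun h s

theorem iteratedDeriv_cardinalBSpline_symm (k m : ℕ) (s : ℝ) :
    iteratedDeriv k (cardinalBSpline (m + 1)) ((m : ℝ) + 2 - s)
      = (-1) ^ k * iteratedDeriv k (cardinalBSpline (m + 1)) s := by
  have h := congrFun (iteratedDeriv_comp_const_sub k (cardinalBSpline (m + 1)) ((m : ℝ) + 2)) s
  rw [funext (cardinalBSpline_succ_sub_self m)] at h
  rw [h, smul_eq_mul, ← mul_assoc, ← mul_pow]
  simp

/-! ### Convolutions and correlations. -/

theorem integral_cardinalBSpline_zero_smul {E : Type*} [NormedAddCommGroup E] [NormedSpace ℝ E]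
    (g : ℝ → E) : ∫ x, cardinalBSpline 0 x • g x = ∫ u in (0 : ℝ)..1, g u := by
  rw [intervalIntegral.integral_of_le zero_le_one, integral_Ioc_eq_integral_Ioo,
    ← integral_Ico_eq_integral_Ioo, ← integral_indicator measurableSet_Ico]
  congr 1 with x
  rw [cardinalBSpline_zero_apply]
  by_cases hx : x ∈ Ico (0 : ℝ) 1
  · rw [indicator_of_mem hx, if_pos (mem_Ico.1 hx), one_smul]
  · rw [indicator_of_notMem hx, if_neg (mt mem_Ico.2 hx), zero_smul]

/-- Integration against a cardinal B-spline of degree `m + 1` averages the integrals against the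
translates of the cardinal B-spline of degree `m`. -/
theorem integral_cardinalBSpline_succ_smul {E : Type*} [NormedAddCommGroup E] [NormedSpace ℝ E]
    [CompleteSpace E] (m : ℕ) {g : ℝ → E} (hg : StronglyMeasurable g) {c : ℝ} (hc : ∀ x, ‖g x‖ ≤ c) :
    ∫ x, cardinalBSpline (m + 1) x • g x
      = ∫ u in (0 : ℝ)..1, ∫ x, cardinalBSpline m x • g (x + u) := by
  -- Joint integrability for Fubini: a convolution integrand of two integrable functions, times the
  -- bounded `g`.
  have hint : Integrable (fun q : ℝ × ℝ => cardinalBSpline m (q.1 - q.2) • g q.1)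
      (volume.prod (volume.restrict (Ioc 0 1))) := by
    have h1 : Integrable (fun _ : ℝ => (1 : ℝ)) (volume.restrict (Ioc 0 1)) :=
      integrable_const _
    have h2 := h1.convolution_integrand (ContinuousLinearMap.mul ℝ ℝ)
      (integrable_cardinalBSpline m)
    simp only [ContinuousLinearMap.mul_apply', one_mul] at h2
    exact h2.smul_bdd c (hg.comp_measurable measurable_fst).aestronglyMeasurable
      (ae_of_all _ fun q => hc q.1)
  calc ∫ x, cardinalBSpline (m + 1) x • g x
      = ∫ x, ∫ u in Ioc (0 : ℝ) 1, cardinalBSpline m (x - u) • g x := by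
        congr 1 with x
        rw [cardinalBSpline_succ_eq_integral, intervalIntegral.integral_of_le zero_le_one,
          integral_smul_const]
    _ = ∫ u in Ioc (0 : ℝ) 1, ∫ x, cardinalBSpline m (x - u) • g x :=
        integral_integral_swap hint
    _ = ∫ u in (0 : ℝ)..1, ∫ x, cardinalBSpline m x • g (x + u) := by
        rw [intervalIntegral.integral_of_le zero_le_one]
        congr 1 with u
        rw [← integral_sub_right_eq_self (fun x => cardinalBSpline m x • g (x + u)) u]
        simp

/-- The convolution of two cardinal B-splines is a cardinal B-spline. -/
theorem integral_cardinalBSpline_mul_cardinalBSpline (a b : ℕ) (x : ℝ) :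
    ∫ t, cardinalBSpline a t * cardinalBSpline b (x - t) = cardinalBSpline (a + b + 1) x := by
  induction a generalizing x with
  | zero =>
    simp_rw [← smul_eq_mul]
    rw [integral_cardinalBSpline_zero_smul (fun t => cardinalBSpline b (x - t)), zero_add,
      cardinalBSpline_succ_eq_integral]
  | succ a ih =>
    obtain ⟨c, hc⟩ := exists_abs_cardinalBSpline_le b
    have h := integral_cardinalBSpline_succ_smul a (g := fun t => cardinalBSpline b (x - t))
      ((measurable_cardinalBSpline b).comp (measurable_const.sub measurable_id)).stronglyMeasurable
      (fun t => hc (x - t))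
    simp only [smul_eq_mul] at h
    rw [h, show a + 1 + b + 1 = a + b + 1 + 1 by ring, cardinalBSpline_succ_eq_integral]
    congr 1 with u
    rw [← ih (x - u)]
    congr 1 with t
    rw [show x - (t + u) = x - u - t by ring]

theorem integrable_backwardDiff_iterate {f : ℝ → ℝ} (hf : Integrable f) (k : ℕ) :
    Integrable (backwardDiff^[k] f) := by
  induction k with
  | zero => exact hf
  | succ k ih =>
    rw [Function.iterate_succ_apply']
    exact ih.sub (ih.comp_sub_right 1)

theorem measurable_backwardDiff_iterate {f : ℝ → ℝ} (hf : Measurable f) (k : ℕ) :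
    Measurable (backwardDiff^[k] f) := by
  induction k with
  | zero => exact hf
  | succ k ih =>
    rw [Function.iterate_succ_apply']
    exact ih.sub (ih.comp (measurable_id.sub_const 1))

theorem exists_abs_backwardDiff_iterate_le {f : ℝ → ℝ} (hf : ∃ c, ∀ s, |f s| ≤ c) (k : ℕ) :
    ∃ c, ∀ s, |backwardDiff^[k] f s| ≤ c := by
  induction k with
  | zero => exact hf
  | succ k ih =>
    obtain ⟨c, hc⟩ := ih
    refine ⟨c + c, fun s => ?_⟩
    rw [Function.iterate_succ_apply']
    exact (abs_sub _ _).trans (add_le_add (hc _) (hc _))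

theorem integrable_mul_comp_sub_left {f g : ℝ → ℝ} (hf : Integrable f) (hg : Measurable g)
    (hb : ∃ c, ∀ s, |g s| ≤ c) (x : ℝ) : Integrable fun t => f t * g (x - t) := by
  obtain ⟨c, hc⟩ := hb
  exact hf.mul_bdd (hg.comp (measurable_const.sub measurable_id)).aestronglyMeasurable
    (ae_of_all _ fun t => hc (x - t))

theorem integral_mul_backwardDiff {f g : ℝ → ℝ} (hf : Integrable f) (hg : Measurable g)
    (hb : ∃ c, ∀ s, |g s| ≤ c) (x : ℝ) :
    ∫ t, f t * backwardDiff g (x - t) = backwardDiff (fun y => ∫ t, f t * g (y - t)) x := by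
  simp only [backwardDiff]
  rw [← integral_sub (integrable_mul_comp_sub_left hf hg hb x)
    (integrable_mul_comp_sub_left hf hg hb (x - 1))]
  congr 1 with t
  rw [mul_sub, show x - t - 1 = x - 1 - t by ring]

theorem integral_backwardDiff_mul {f g : ℝ → ℝ} (hf : Integrable f) (hg : Measurable g)
    (hb : ∃ c, ∀ s, |g s| ≤ c) (x : ℝ) :
    ∫ t, backwardDiff f t * g (x - t) = backwardDiff (fun y => ∫ t, f t * g (y - t)) x := by
  simp only [backwardDiff, sub_mul]
  rw [integral_sub (integrable_mul_comp_sub_left hf hg hb x)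
    (integrable_mul_comp_sub_left (hf.comp_sub_right 1) hg hb x),
    ← integral_sub_right_eq_self (fun t => f t * g (x - 1 - t)) 1]
  congr 2 with t
  rw [show x - 1 - (t - 1) = x - t by ring]

/-- Backward differences commute with translation, hence can be pulled out of either factor of a
convolution. -/
theorem integral_backwardDiff_iterate_cardinalBSpline (a b k l : ℕ) (x : ℝ) :
    ∫ t, backwardDiff^[k] (cardinalBSpline a) t * backwardDiff^[l] (cardinalBSpline b) (x - t)
      = backwardDiff^[k + l] (cardinalBSpline (a + b + 1)) x := by
  induction k generalizing x with
  | zero =>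
    induction l generalizing x with
    | zero => exact integral_cardinalBSpline_mul_cardinalBSpline a b x
    | succ l ih =>
      rw [← add_assoc]
      simp only [Function.iterate_succ_apply', Function.iterate_zero, id] at ih ⊢
      rw [integral_mul_backwardDiff (integrable_cardinalBSpline a)
        (measurable_backwardDiff_iterate (measurable_cardinalBSpline b) l)
        (exists_abs_backwardDiff_iterate_le (exists_abs_cardinalBSpline_le b) l)]
      exact congrArg (fun F => backwardDiff F x) (funext ih)
  | succ k ih =>
    rw [add_right_comm]
    simp only [Function.iterate_succ_apply']
    rw [integral_backwardDiff_mul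
      (integrable_backwardDiff_iterate (integrable_cardinalBSpline a) k)
      (measurable_backwardDiff_iterate (measurable_cardinalBSpline b) l)
      (exists_abs_backwardDiff_iterate_le (exists_abs_cardinalBSpline_le b) l)]
    exact congrArg (fun F => backwardDiff F x) (funext ih)

theorem ae_notMem_range_intCast (a : ℝ) : ∀ᵐ t : ℝ, a - t ∈ (range ((↑) : ℤ → ℝ))ᶜ := by
  have h : (range fun n : ℤ => a - n).Countable := countable_range _
  filter_upwards [h.ae_notMem volume] with t ht
  rintro ⟨n, hn⟩
  exact ht ⟨n, by simp only; linarith⟩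

/-- The correlation of the derivatives of order `k ≤ p` of two translates of a cardinal B-spline. -/
theorem integral_iteratedDeriv_cardinalBSpline_mul {p k : ℕ} (hp : 1 ≤ p) (hk : k ≤ p) (y : ℝ) :
    ∫ t, iteratedDeriv k (cardinalBSpline p) (t - y) * iteratedDeriv k (cardinalBSpline p) t
      = (-1) ^ k * iteratedDeriv (2 * k) (cardinalBSpline (2 * p + 1)) ((p : ℝ) + 1 + y) := by
  obtain ⟨m, rfl⟩ := Nat.exists_eq_add_of_le' hk
  obtain ⟨r, hr⟩ := Nat.exists_eq_add_of_le' hp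
  -- Reflecting one factor turns the correlation into a convolution and produces the sign.
  have hsymm : ∀ t, iteratedDeriv k (cardinalBSpline (m + k)) (t - y)
      = (-1) ^ k * iteratedDeriv k (cardinalBSpline (m + k)) (((m + k : ℕ) : ℝ) + 1 + y - t) := by
    intro t
    rw [hr, ← iteratedDeriv_cardinalBSpline_symm]
    congr 1
    push_cast
    ring
  have h := integral_backwardDiff_iterate_cardinalBSpline m m k k (((m + k : ℕ) : ℝ) + 1 + y)
  rw [show 2 * (m + k) + 1 = 2 * m + 1 + 2 * k by ring, iteratedDeriv_cardinalBSpline,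
    two_mul k, two_mul m, ← h, ← integral_const_mul]
  refine integral_congr_ae ?_
  filter_upwards [ae_notMem_range_intCast (((m + k : ℕ) : ℝ) + 1 + y),
    (countable_range ((↑) : ℤ → ℝ)).ae_notMem volume] with t h1 h2
  rw [hsymm, iteratedDeriv_cardinalBSpline_of_notMem k m h1,
    iteratedDeriv_cardinalBSpline_of_notMem k m h2]
  ring

/-! ### Fourier transform and Poisson summation. -/

theorem integral_cardinalBSpline_smul_exp (m : ℕ) (ω : ℝ) :
    ∫ x : ℝ, cardinalBSpline m x • Complex.exp (-(Complex.I * ω) * x)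
      = (∫ u in (0 : ℝ)..1, Complex.exp (-(Complex.I * ω) * u)) ^ (m + 1) := by
  induction m with
  | zero =>
    rw [integral_cardinalBSpline_zero_smul fun x : ℝ => Complex.exp (-(Complex.I * ω) * x)]
    simp
  | succ m ih =>
    have hc : Continuous fun x : ℝ => Complex.exp (-(Complex.I * ω) * x) := by fun_prop
    rw [integral_cardinalBSpline_succ_smul m hc.stronglyMeasurable (c := 1)
      fun x => by simp [Complex.norm_exp], pow_succ', ← ih,
      ← intervalIntegral.integral_mul_const]
    congr 1 with u
    rw [← integral_const_mul]
    congr 1 with x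
    rw [mul_smul_comm, ← Complex.exp_add]
    push_cast
    ring_nf

theorem integral_exp_zero_one {ω : ℝ} (hω : ω ≠ 0) :
    ∫ u in (0 : ℝ)..1, Complex.exp (-(Complex.I * ω) * u)
      = (1 - Complex.exp (-(Complex.I * ω))) / (Complex.I * ω) := by
  have h : Complex.I * (ω : ℂ) ≠ 0 :=
    mul_ne_zero Complex.I_ne_zero (Complex.ofReal_ne_zero.2 hω)
  rw [integral_exp_mul_complex (neg_ne_zero.2 h)]
  simp only [Complex.ofReal_one, Complex.ofReal_zero, mul_one, mul_zero, Complex.exp_zero]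
  rw [div_neg, ← neg_div, neg_sub]

theorem two_sub_two_mul_cos (θ : ℝ) :
    ((2 - 2 * Real.cos θ : ℝ) : ℂ) * Complex.exp (Complex.I * θ)
      = -(1 - Complex.exp (Complex.I * θ)) ^ 2 := by
  have h : Complex.exp (-θ * Complex.I) * Complex.exp (Complex.I * θ) = 1 := by
    rw [← Complex.exp_add, show -(θ : ℂ) * Complex.I + Complex.I * θ = 0 by ring, Complex.exp_zero]
  push_cast
  rw [Complex.two_cos, mul_comm (θ : ℂ) Complex.I]
  linear_combination -h

theorem summable_one_div_add_two_mul_int_mul_pi_pow (θ : ℝ) {k : ℕ} (hk : 2 ≤ k) :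
    Summable fun j : ℤ => 1 / (θ + 2 * j * Real.pi) ^ k := by
  have h := (Real.summable_one_div_int_add_rpow (θ / (2 * Real.pi)) k).2
    (by exact_mod_cast hk)
  refine Summable.of_norm_bounded (h.mul_left (1 / (2 * Real.pi) ^ k)) fun j => ?_
  have hpi := Real.pi_pos
  have h2 : θ + 2 * j * Real.pi = 2 * Real.pi * (j + θ / (2 * Real.pi)) := by
    field_simp
    ring
  rw [Real.rpow_natCast, norm_div, norm_one, norm_pow, Real.norm_eq_abs, div_mul_div_comm, one_mul,
    h2, abs_mul, abs_of_pos (show 0 < 2 * Real.pi by positivity), mul_pow]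

/-- Poisson summation for `Φ_{m+1}(x) exp (iθx)`: the modulation shifts the frequencies `2πn` to
`2πn - θ`. Compact support settles the decay of the function; summability on the Fourier side is
left to the cases `θ ∉ 2πℤ` and `θ = 0`. -/
theorem tsum_cardinalBSpline_mul_zpow (m : ℕ) (θ : ℝ)
    (hs : Summable fun n : ℤ =>
      (∫ u in (0 : ℝ)..1, Complex.exp (-(Complex.I * (2 * Real.pi * n - θ : ℝ)) * u)) ^ (m + 2)) :
    ∑' n : ℤ, (cardinalBSpline (m + 1) n : ℂ) * Complex.exp (Complex.I * θ) ^ n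
      = ∑' n : ℤ, (∫ u in (0 : ℝ)..1,
          Complex.exp (-(Complex.I * (2 * Real.pi * n - θ : ℝ)) * u)) ^ (m + 2) := by
  set f : ℝ → ℂ := fun x => cardinalBSpline (m + 1) x * Complex.exp (Complex.I * θ * x) with hf
  have hcont : Continuous f := by
    have := continuous_cardinalBSpline_succ m
    fun_prop
  have hF : ∀ n : ℤ, 𝓕 f n = (∫ u in (0 : ℝ)..1,
      Complex.exp (-(Complex.I * (2 * Real.pi * n - θ : ℝ)) * u)) ^ (m + 2) := by
    intro n
    rw [← integral_cardinalBSpline_smul_exp (m + 1), Real.fourier_real_eq_integral_exp_smul]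
    congr 1 with x
    rw [hf, smul_eq_mul, Complex.real_smul, mul_left_comm, ← Complex.exp_add]
    congr 2
    push_cast
    ring
  have hO : f =O[cocompact ℝ] fun x : ℝ => |x| ^ (-2 : ℝ) := by
    refine Filter.EventuallyEq.trans_isBigO (f₂ := fun _ => (0 : ℂ)) ?_
      (Asymptotics.isBigO_zero _ _)
    filter_upwards [(isCompact_Icc (a := (0 : ℝ)) (b := (m + 1 : ℕ) + 1)).compl_mem_cocompact]
      with x hx
    have : cardinalBSpline (m + 1) x = 0 :=
      Function.notMem_support.1 fun h => hx (support_cardinalBSpline_subset (m + 1) h)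
    simp [hf, this]
  have h := Real.tsum_eq_tsum_fourier_of_rpow_decay_of_summable hcont one_lt_two hO
    (by simpa only [hF] using hs) 0
  simp only [hF, QuotientAddGroup.mk_zero, fourier_eval_zero, mul_one, zero_add] at h
  rw [← h]
  congr 1 with n
  rw [hf, ← Complex.exp_int_mul, mul_comm (n : ℂ)]
  simp

theorem tsum_cardinalBSpline_odd (r : ℕ) {θ : ℝ} (hθ : ∀ j : ℤ, θ + 2 * j * Real.pi ≠ 0) :
    ∑' n : ℤ, (cardinalBSpline (2 * r + 1) n : ℂ) * Complex.exp (Complex.I * θ) ^ n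
      = Complex.exp (Complex.I * θ) ^ (r + 1)
        * (((2 - 2 * Real.cos θ) ^ (r + 1)
          * ∑' j : ℤ, 1 / (θ + 2 * j * Real.pi) ^ (2 * r + 2) : ℝ) : ℂ) := by
  have hE : ∀ n : ℤ, (∫ u in (0 : ℝ)..1,
      Complex.exp (-(Complex.I * (2 * Real.pi * n - θ : ℝ)) * u)) ^ (2 * r + 2)
      = Complex.exp (Complex.I * θ) ^ (r + 1) * (((2 - 2 * Real.cos θ) ^ (r + 1)
          * (1 / (θ + 2 * (-n : ℤ) * Real.pi) ^ (2 * r + 2)) : ℝ) : ℂ) := by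
    -- All frequencies `2πn - θ` give the same numerator `1 - z`; only the denominator depends on
    -- `n`. The series in the symbol is indexed by `-n`.
    intro n
    have hω : 2 * Real.pi * n - θ ≠ 0 := fun h => hθ (-n) (by push_cast; linarith)
    have hexp : Complex.exp (-(Complex.I * (2 * Real.pi * n - θ : ℝ)))
        = Complex.exp (Complex.I * θ) := by
      rw [Complex.exp_eq_exp_iff_exists_int]
      exact ⟨-n, by push_cast; ring⟩
    rw [integral_exp_zero_one hω, hexp, show 2 * r + 2 = 2 * (r + 1) by ring, pow_mul, div_pow,
      mul_pow, Complex.I_sq, neg_one_mul, div_neg, ← neg_div, ← two_sub_two_mul_cos,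
      show θ + 2 * (-n : ℤ) * Real.pi = -(2 * Real.pi * n - θ) by push_cast; ring,
      Even.neg_pow ⟨r + 1, by ring⟩, pow_mul, div_pow, mul_pow]
    push_cast
    rw [mul_one_div, mul_div_assoc, mul_div_left_comm]
  have hsum := summable_one_div_add_two_mul_int_mul_pi_pow θ (k := 2 * r + 2) (by omega)
  have hsum' := (Equiv.neg ℤ).summable_iff.2 hsum
  have hneg := (Equiv.neg ℤ).tsum_eq fun j : ℤ => 1 / (θ + 2 * j * Real.pi) ^ (2 * r + 2)
  simp only [Equiv.neg_apply] at hneg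
  rw [tsum_cardinalBSpline_mul_zpow (2 * r) θ]
  · simp only [hE]
    rw [tsum_mul_left, ← Complex.ofReal_tsum, tsum_mul_left, hneg]
  · simp only [hE]
    exact (Complex.summable_ofReal.2 (hsum'.mul_left _)).mul_left _

/-- At `θ = 0` only the zero frequency survives in the Poisson sum. -/
theorem tsum_cardinalBSpline_succ_intCast (m : ℕ) :
    ∑' n : ℤ, (cardinalBSpline (m + 1) n : ℂ) = 1 := by
  have hE : ∀ n : ℤ, (∫ u in (0 : ℝ)..1,
      Complex.exp (-(Complex.I * (2 * Real.pi * n - 0 : ℝ)) * u)) ^ (m + 2)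
      = if n = 0 then 1 else 0 := by
    intro n
    split_ifs with hn
    · simp [hn]
    · have hω : 2 * Real.pi * n - 0 ≠ 0 := by
        simp [hn, Real.pi_ne_zero]
      have hexp : Complex.exp (-(Complex.I * (2 * Real.pi * n - 0 : ℝ))) = 1 := by
        rw [Complex.exp_eq_one_iff]
        exact ⟨-n, by push_cast; ring⟩
      rw [integral_exp_zero_one hω, hexp]
      simp
  have h := tsum_cardinalBSpline_mul_zpow m 0
  simp only [hE] at h
  simpa using h (summable_of_ne_finset_zero (s := {0}) fun n hn => by simpa using hn)

theorem tsum_cardinalBSpline_one_mul_zpow (z : ℂ) :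
    ∑' n : ℤ, (cardinalBSpline 1 n : ℂ) * z ^ n = z := by
  rw [tsum_eq_single 1]
  · simp [cardinalBSpline_one_apply]
    norm_num
  · intro n hn
    have : cardinalBSpline 1 n = 0 := by
      rcases lt_or_gt_of_ne hn with h | h
      · rw [cardinalBSpline_one_apply, max_eq_left]
        exact (min_le_left _ _).trans (by exact_mod_cast Int.lt_add_one_iff.1 h)
      · refine cardinalBSpline_of_ge 1 ?_
        have : (1 : ℤ) + 1 ≤ n := h
        exact_mod_cast this
    simp [this]

/-! ### From generating functions to the three symbols. -/

/-- Translation by one multiplies the generating function by `z`. -/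
theorem hasSum_backwardDiff_iterate {f : ℝ → ℝ} {z S : ℂ} (hz : z ≠ 0)
    (h : HasSum (fun n : ℤ => (f n : ℂ) * z ^ n) S) (k : ℕ) :
    HasSum (fun n : ℤ => (backwardDiff^[k] f n : ℂ) * z ^ n) ((1 - z) ^ k * S) := by
  induction k with
  | zero => simpa using h
  | succ k ih =>
    have h' := ((Equiv.subRight (1 : ℤ)).hasSum_iff.2 ih).mul_right z
    have := ih.sub h'
    rw [pow_succ', mul_assoc, sub_mul, one_mul, mul_comm z]
    refine this.congr_fun fun n => ?_
    simp only [Function.iterate_succ_apply', backwardDiff, Function.comp_apply,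
      Equiv.subRight_apply]
    rw [mul_assoc, ← zpow_add_one₀ hz]
    push_cast
    ring_nf

theorem cardinalBSpline_succ_of_nonpos (m : ℕ) {s : ℝ} (hs : s ≤ 0) :
    cardinalBSpline (m + 1) s = 0 := by
  rcases hs.lt_or_eq with h | rfl
  exacts [cardinalBSpline_of_neg _ h, cardinalBSpline_succ_zero m]

theorem backwardDiff_iterate_of_nonpos {f : ℝ → ℝ} (hf : ∀ s ≤ 0, f s = 0) (k : ℕ) :
    ∀ s ≤ 0, backwardDiff^[k] f s = 0 := by
  induction k with
  | zero => exact hf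
  | succ k ih =>
    intro s hs
    rw [Function.iterate_succ_apply', backwardDiff, ih s hs, ih (s - 1) (by linarith), sub_zero]

theorem hasSum_even_mul_zpow {a : ℤ → ℂ} {p : ℕ} (hsupp : ∀ d : ℤ, (p : ℤ) < d → a d = 0)
    (heven : ∀ d, a (-d) = a d) (z : ℂ) :
    HasSum (fun d : ℤ => a d * z ^ d)
      (a 0 + ∑ j ∈ Finset.Icc 1 p, a (-j) * (z ^ (-(j : ℤ)) + z ^ (j : ℤ))) := by
  have h1 : HasSum (fun n : ℕ => a n * z ^ (n : ℤ)) (∑ n ∈ Finset.range (p + 1), a n * z ^ (n : ℤ)) :=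
    hasSum_sum_of_ne_finset_zero fun n hn => by
      rw [hsupp n (by simpa using hn), zero_mul]
  have h2 : HasSum (fun n : ℕ => a (-(n + 1)) * z ^ (-((n : ℤ) + 1)))
      (∑ n ∈ Finset.range p, a (-(n + 1)) * z ^ (-((n : ℤ) + 1))) :=
    hasSum_sum_of_ne_finset_zero fun n hn => by
      rw [heven, hsupp _ (by simpa [Int.lt_add_one_iff] using hn), zero_mul]
  have h3 := HasSum.of_nat_of_neg_add_one (f := fun d : ℤ => a d * z ^ d) h1 h2
  rw [Finset.sum_range_succ', add_right_comm, ← Finset.sum_add_distrib, add_comm] at h3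
  have h4 : ∀ q : ℕ, ∑ j ∈ Finset.Icc 1 q, a (-j) * (z ^ (-(j : ℤ)) + z ^ (j : ℤ))
      = ∑ n ∈ Finset.range q, (a ((n + 1 : ℕ) : ℤ) * z ^ ((n + 1 : ℕ) : ℤ)
        + a (-(n + 1)) * z ^ (-((n : ℤ) + 1))) := by
    intro q
    induction q with
    | zero => simp
    | succ q ih =>
      rw [Finset.sum_Icc_succ_top (by omega), ih, Finset.sum_range_succ, Nat.cast_succ, heven]
      ring
  rw [h4]
  simpa using h3

theorem exp_pow_mul_splineSum {p k m : ℕ} (hk : Even k) (hkm : m + k = 2 * p) (θ : ℝ) :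
    Complex.exp (Complex.I * θ) ^ (p + 1) * splineSum p k θ
      = (1 - Complex.exp (Complex.I * θ)) ^ k
        * ∑' n : ℤ, (cardinalBSpline (m + 1) n : ℂ) * Complex.exp (Complex.I * θ) ^ n := by
  set z := Complex.exp (Complex.I * θ) with hz
  have hz0 : z ≠ 0 := Complex.exp_ne_zero _
  have hsum : Summable fun n : ℤ => (cardinalBSpline (m + 1) n : ℂ) * z ^ n := by
    refine summable_of_ne_finset_zero (s := Finset.Icc 0 ((m : ℤ) + 2)) fun n hn => ?_
    have : cardinalBSpline (m + 1) n = 0 := by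
      refine Function.notMem_support.1 fun h => hn ?_
      have := support_cardinalBSpline_subset (m + 1) h
      rw [Finset.mem_Icc]
      constructor
      · exact_mod_cast this.1
      · have h2 := this.2
        push_cast at h2
        have h3 : ((n : ℤ) : ℝ) ≤ ((m + 2 : ℤ) : ℝ) := by push_cast; linarith
        exact_mod_cast h3
    simp [this]
  have hder : iteratedDeriv k (cardinalBSpline (2 * p + 1))
      = backwardDiff^[k] (cardinalBSpline (m + 1)) := by
    rw [← hkm, show m + k + 1 = m + 1 + k by ring, iteratedDeriv_cardinalBSpline]
  have h1 := hasSum_backwardDiff_iterate hz0 hsum.hasSum k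
  rw [← hder] at h1
  have hsymm : ∀ s, iteratedDeriv k (cardinalBSpline (2 * p + 1)) ((p : ℝ) + 1 - s)
      = iteratedDeriv k (cardinalBSpline (2 * p + 1)) ((p : ℝ) + 1 + s) := by
    intro s
    have := iteratedDeriv_cardinalBSpline_symm k (2 * p) ((p : ℝ) + 1 + s)
    rw [hk.neg_one_pow, one_mul] at this
    rw [← this]
    congr 1
    push_cast
    ring
  have h2 := hasSum_even_mul_zpow
    (a := fun d : ℤ => ((iteratedDeriv k (cardinalBSpline (2 * p + 1)) ((p : ℝ) + 1 + d) : ℝ) : ℂ))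
    -- By symmetry the value at `p + 1 + d` is the one at `p + 1 - d ≤ 0`, where the spline of
    -- positive degree `m + 1` and its differences vanish, the endpoint `0` included.
    (p := p) (fun d hd => by
      rw [← hsymm, hder, backwardDiff_iterate_of_nonpos
        (fun s hs => cardinalBSpline_succ_of_nonpos m hs), Complex.ofReal_zero]
      have : (p : ℤ) + 1 ≤ d := hd
      have : (p : ℝ) + 1 ≤ d := by exact_mod_cast this
      linarith)
    (fun d => by rw [← hsymm]; push_cast; ring_nf) z
  have h3 := ((Equiv.addLeft ((p : ℤ) + 1)).hasSum_iff.2 h1)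
  have h4 := h2.mul_left (z ^ (p + 1))
  refine (Eq.trans ?_ (h4.unique (h3.congr_fun fun d => ?_)))
  · congr 1
    simp only [splineSum, Int.cast_zero, add_zero]
    congr 1
    refine Finset.sum_congr rfl fun j _ => ?_
    rw [hz, ← Complex.exp_int_mul, ← Complex.exp_int_mul]
    push_cast
    ring_nf
  · simp only [Function.comp_apply, Equiv.coe_addLeft]
    rw [zpow_add₀ hz0]
    push_cast
    norm_cast
    ring

theorem add_two_mul_int_mul_pi_ne_zero {θ : ℝ} (hθ : θ ∈ Icc (-Real.pi) Real.pi) (h0 : θ ≠ 0)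
    (j : ℤ) : θ + 2 * j * Real.pi ≠ 0 := by
  intro h
  have hpi := Real.pi_pos
  have hj : j ≠ 0 := by
    rintro rfl
    exact h0 (by simpa using h)
  have h1 : (1 : ℝ) ≤ |(j : ℝ)| := by exact_mod_cast Int.one_le_abs hj
  have h2 : |θ| = 2 * |(j : ℝ)| * Real.pi := by
    rw [eq_neg_of_add_eq_zero_left h, abs_neg, abs_mul, abs_mul, abs_two, abs_of_pos hpi]
  have h3 : |θ| ≤ Real.pi := abs_le.2 hθ
  nlinarith

theorem exp_I_mul_pow_ne_zero (θ : ℝ) (n : ℕ) : Complex.exp (Complex.I * θ) ^ n ≠ 0 :=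
  pow_ne_zero _ (Complex.exp_ne_zero _)

theorem splineSum_zero_eq_symbolM (p : ℕ) {θ : ℝ} (hθ : θ ∈ Icc (-Real.pi) Real.pi) :
    splineSum p 0 θ = (symbolM p θ : ℂ) := by
  refine mul_left_cancel₀ (exp_I_mul_pow_ne_zero θ (p + 1)) ?_
  rw [exp_pow_mul_splineSum (m := 2 * p) Even.zero rfl, pow_zero, one_mul, symbolM]
  split_ifs with h
  · subst h
    simpa using tsum_cardinalBSpline_succ_intCast (2 * p)
  · exact tsum_cardinalBSpline_odd p (add_two_mul_int_mul_pi_ne_zero hθ h)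

theorem splineSum_two_eq_symbolB {p : ℕ} (hp : 1 ≤ p) {θ : ℝ}
    (hθ : θ ∈ Icc (-Real.pi) Real.pi) : splineSum p 2 θ = (symbolB p θ : ℂ) := by
  -- Two differentiations lower the degree to `2p - 1 = 2r + 1`; the factor `(1 - z) ^ 2` supplies
  -- the sign, the missing power of `2 - 2 cos θ` and the missing `z`.
  obtain ⟨r, rfl⟩ := Nat.exists_eq_add_of_le' hp
  refine mul_left_cancel₀ (exp_I_mul_pow_ne_zero θ (r + 1 + 1)) ?_
  rw [exp_pow_mul_splineSum (m := 2 * r) even_two (by ring), symbolB]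
  split_ifs with h
  · subst h
    simp
  · rw [tsum_cardinalBSpline_odd r (add_two_mul_int_mul_pi_ne_zero hθ h),
      ← neg_neg ((1 - Complex.exp (Complex.I * θ)) ^ 2), ← two_sub_two_mul_cos,
      show 2 * (r + 1) = 2 * r + 2 by ring]
    push_cast
    ring

theorem splineSum_two_mul_eq_symbolD (p : ℕ) (θ : ℝ) :
    splineSum p (2 * p) θ = (symbolD p θ : ℂ) := by
  refine mul_left_cancel₀ (exp_I_mul_pow_ne_zero θ (p + 1)) ?_
  rw [exp_pow_mul_splineSum (m := 0) (even_two_mul p) (by ring), symbolD,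
    tsum_cardinalBSpline_one_mul_zpow, pow_mul,
    ← neg_neg ((1 - Complex.exp (Complex.I * θ)) ^ 2), ← two_sub_two_mul_cos, ← neg_one_mul,
    mul_pow, mul_pow]
  push_cast
  ring

theorem continuous_splineSum (p k : ℕ) : Continuous (splineSum p k) := by
  unfold splineSum
  fun_prop

/-- Continuity of the symbols at `0` needs no limit of the series: they agree with trigonometric
polynomials. -/
theorem continuousOn_of_splineSum_eq {p k : ℕ} {f : ℝ → ℝ} {S : Set ℝ}
    (h : ∀ θ ∈ S, splineSum p k θ = (f θ : ℂ)) : ContinuousOn f S :=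
  (Complex.continuous_re.comp (continuous_splineSum p k)).continuousOn.congr fun θ hθ => by
    simp [h θ hθ]

theorem aeval_qPoly (p : ℕ) (ρ δ θ : ℝ) :
    Polynomial.aeval (Complex.exp (Complex.I * θ)) (qPoly p ρ δ)
      = Complex.exp (Complex.I * p * θ) * (splineSum p 2 θ + ρ * (splineSum p 0 θ
        + δ * (-1) ^ p * splineSum p (2 * p) θ)) := by
  have key : splineSum p 2 θ + ρ * (splineSum p 0 θ + δ * (-1) ^ p * splineSum p (2 * p) θ)
      = (kCoeff p ρ δ p : ℂ) + ∑ j ∈ Finset.Icc 1 p, (kCoeff p ρ δ (p - j) : ℂ)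
        * (Complex.exp (-(Complex.I * j * θ)) + Complex.exp (Complex.I * j * θ)) := by
    simp only [splineSum, kCoeff, iteratedDeriv_zero]
    push_cast
    rw [mul_add (_ * _ : ℂ), add_add_add_comm, mul_add (ρ : ℂ), add_add_add_comm,
      Finset.mul_sum, ← Finset.sum_add_distrib, Finset.mul_sum, ← Finset.sum_add_distrib]
    congr 1
    refine Finset.sum_congr rfl fun j hj => ?_
    rw [Nat.cast_sub (Finset.mem_Icc.1 hj).2, sub_add_eq_add_sub]
    ring
  rw [key, qPoly, map_add, map_sum, mul_add, Finset.mul_sum]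
  have hE : ∀ n : ℕ, Complex.exp (Complex.I * θ) ^ n = Complex.exp (Complex.I * n * θ) := by
    intro n
    rw [← Complex.exp_nat_mul]
    ring_nf
  congr 1
  · simp only [map_mul, map_pow, Polynomial.aeval_C, Polynomial.aeval_X, hE,
      Complex.coe_algebraMap]
    exact mul_comm _ _
  · refine Finset.sum_congr rfl fun j hj => ?_
    simp only [map_mul, map_add, map_pow, Polynomial.aeval_C, Polynomial.aeval_X, hE]
    rw [mul_left_comm, mul_add (Complex.exp _), ← Complex.exp_add, ← Complex.exp_add,
      Nat.cast_sub (Finset.mem_Icc.1 hj).2]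
    simp only [Complex.coe_algebraMap]
    push_cast
    ring_nf

/-! ### B-splines on the open knot vector and the Galerkin entries. -/

theorem bspline_eq_zero_of_notMem (ξ : ℕ → ℝ) (k j : ℕ) {t : ℝ}
    (ht : t ∉ Ico (ξ j) (ξ (j + k + 1))) : bspline ξ k j t = 0 := by
  cases k with
  | zero => exact if_neg ht
  | succ k => exact if_neg ht

/-- On equidistant knots the B-splines are scaled and shifted cardinal B-splines. -/
theorem bspline_eq_cardinalBSpline {ξ : ℕ → ℝ} {h : ℝ} (hh : 0 < h) {k j : ℕ} {a : ℝ}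
    (hξ : ∀ r ≤ k + 1, ξ (j + r) = h * (a + r)) (t : ℝ) :
    bspline ξ k j t = cardinalBSpline k (t / h - a) := by
  induction k generalizing j a with
  | zero =>
    have h0 := hξ 0 (by omega)
    have h1 := hξ 1 (by omega)
    simp only [add_zero, Nat.cast_zero, Nat.cast_one] at h0 h1
    rw [bspline, cardinalBSpline_zero_apply, h0, h1]
    congr 1
    rw [sub_nonneg, le_div_iff₀ hh, sub_lt_iff_lt_add', div_lt_iff₀ hh, mul_comm h, mul_comm h]
  | succ k ih =>
    have h0 := hξ 0 (by omega)
    have h1 := hξ 1 (by omega)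
    have h2 := hξ (k + 1) (by omega)
    have h3 := hξ (k + 2) (by omega)
    simp only [add_zero, Nat.cast_zero, ← add_assoc] at h0 h2 h3
    push_cast at h1 h2 h3
    have hk : (k : ℝ) + 1 ≠ 0 := by positivity
    have e1 := ih (j := j) (a := a) fun r hr => hξ r (by omega)
    have e2 := ih (j := j + 1) (a := a + 1) fun r hr => by
      rw [add_assoc, hξ (1 + r) (by omega)]
      push_cast
      ring
    have hlow : t < h * a → t / h - a < 0 := fun hlt => by
      rw [sub_neg, div_lt_iff₀ hh]; linarith
    have hup : h * (a + (k + 2)) ≤ t → ((k + 1 : ℕ) : ℝ) + 1 ≤ t / h - a := fun hle => by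
      push_cast
      rw [le_sub_iff_add_le, le_div_iff₀ hh]; linarith
    rw [bspline, h3, h0]
    split_ifs with hc
    · rw [e1, e2, cardinalBSpline_succ_apply, h1, h2, sub_sub (t / h),
        show h * (a + ((k : ℝ) + 1)) - h * a = h * (k + 1) by ring,
        show h * (a + ((k : ℝ) + 2)) - h * (a + 1) = h * (k + 1) by ring]
      congr 2 <;> field_simp
      ring
    · rw [not_and_or, not_le, not_lt] at hc
      rcases hc with hc | hc
      · exact (cardinalBSpline_of_neg _ (hlow hc)).symm
      · exact (cardinalBSpline_of_ge _ (hup hc)).symm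

theorem iteratedDeriv_comp_div_sub (f : ℝ → ℝ) (h a : ℝ) (k : ℕ) :
    iteratedDeriv k (fun t => f (t / h - a)) = fun t => h⁻¹ ^ k * iteratedDeriv k f (t / h - a) := by
  induction k with
  | zero => simp
  | succ k ih =>
    rw [iteratedDeriv_succ, ih, iteratedDeriv_succ]
    ext t
    simp only [deriv_const_mul_field]
    have := deriv_comp_mul_left h⁻¹ (fun y => iteratedDeriv k f (y - a)) t
    simp only [deriv_comp_sub_const, smul_eq_mul, ← div_eq_inv_mul] at this
    rw [this]
    ring

theorem iteratedDeriv_eq_zero_of_notMem_Icc {f : ℝ → ℝ} {a b : ℝ}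
    (hf : ∀ t ∉ Icc a b, f t = 0) (k : ℕ) {t : ℝ} (ht : t ∉ Icc a b) :
    iteratedDeriv k f t = 0 := by
  have h : EqOn f (fun _ => 0) (Icc a b)ᶜ := fun t ht => hf t ht
  rw [h.iteratedDeriv_of_isOpen isClosed_Icc.isOpen_compl k ht]
  simp

theorem iteratedDeriv_splineBasis_eq_zero (T : ℝ) (N p j k : ℕ) {t : ℝ}
    (ht : t ∉ Icc (knot T N p j) (knot T N p (j + p + 1))) :
    iteratedDeriv k (splineBasis T N p j) t = 0 :=
  iteratedDeriv_eq_zero_of_notMem_Icc (f := splineBasis T N p j)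
    (fun _ h => bspline_eq_zero_of_notMem (knot T N p) p j
      fun h' => h (Ico_subset_Icc_self h')) k ht

theorem meshSize_pos {T : ℝ} (hT : 0 < T) {N : ℕ} (hN : 0 < N) : 0 < meshSize T N :=
  div_pos hT (Nat.cast_pos.2 hN)

theorem knot_mono {T : ℝ} (hT : 0 < T) (N p : ℕ) : Monotone (knot T N p) := by
  intro a b hab
  have : 0 ≤ meshSize T N := div_nonneg hT.le N.cast_nonneg
  refine mul_le_mul_of_nonneg_left ?_ this
  exact_mod_cast min_le_min_right N (Nat.sub_le_sub_right hab p)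

theorem knot_le {T : ℝ} (hT : 0 < T) {N : ℕ} (hN : 0 < N) (p j : ℕ) : knot T N p j ≤ T := by
  have hN' : (N : ℝ) ≠ 0 := (Nat.cast_pos.2 hN).ne'
  calc knot T N p j ≤ meshSize T N * N :=
        mul_le_mul_of_nonneg_left (by exact_mod_cast min_le_right _ _) (meshSize_pos hT hN).le
    _ = T := div_mul_cancel₀ T hN'

/-- The bounds on `j` are those under which the knots `j, …, j + p + 1` avoid the repetitions at
both ends, so neither the truncated subtraction nor the minimum in `knot` takes effect. -/
theorem splineBasis_eq_cardinalBSpline {T : ℝ} (hT : 0 < T) {N p j : ℕ} (hj : p ≤ j)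
    (hjN : j + 1 ≤ N) (t : ℝ) :
    splineBasis T N p j t = cardinalBSpline p (t / meshSize T N - ((j : ℝ) - p)) := by
  refine bspline_eq_cardinalBSpline (meshSize_pos hT (by omega)) (fun r hr => ?_) t
  rw [knot, min_eq_left (by omega), Nat.cast_sub (by omega)]
  push_cast
  ring

theorem iteratedDeriv_splineBasis {T : ℝ} (hT : 0 < T) {N p j : ℕ} (hj : p ≤ j)
    (hjN : j + 1 ≤ N) (k : ℕ) (t : ℝ) :
    iteratedDeriv k (splineBasis T N p j) t = (meshSize T N)⁻¹ ^ k
      * iteratedDeriv k (cardinalBSpline p) (t / meshSize T N - ((j : ℝ) - p)) := by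
  rw [funext (splineBasis_eq_cardinalBSpline hT hj hjN), iteratedDeriv_comp_div_sub]

/-- The entries of the Galerkin matrices inside the Toeplitz band. -/
theorem galerkinMatrix_apply_of_mem_band {T : ℝ} (hT : 0 < T) {N p k : ℕ} (hp : 1 ≤ p)
    (hk : k ≤ p) (i j : Fin (N + p - 1)) (hi : 2 * p ≤ (i : ℕ)) (hiN : (i : ℕ) + p + 1 ≤ N)
    {e : ℕ} (he : e ≤ 2 * p) (hij : (i : ℕ) + e = (j : ℕ) + p + 1) :
    galerkinMatrix T N p k i j = meshSize T N * (meshSize T N)⁻¹ ^ (2 * k)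
      * ((-1) ^ k * iteratedDeriv (2 * k) (cardinalBSpline (2 * p + 1)) ((e : ℝ) + 1)) := by
  have hh : 0 < meshSize T N := meshSize_pos hT (by omega)
  -- Strict positivity puts the closed support of the row function inside `(0, T]`, so the integral
  -- extends to the whole line.
  have hpos : 0 < knot T N p i := by
    refine mul_pos hh (Nat.cast_pos.2 ?_)
    rw [lt_min_iff]
    omega
  rw [galerkinMatrix, intervalIntegral.integral_eq_integral_of_support_subset]
  · have hfun : ∀ t, iteratedDeriv k (splineBasis T N p ((j : ℕ) + 1)) t
        * iteratedDeriv k (splineBasis T N p (i : ℕ)) t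
        = (meshSize T N)⁻¹ ^ (2 * k) * (fun s => iteratedDeriv k (cardinalBSpline p)
          (s - ((i : ℝ) - p) - ((e : ℝ) - p)) * iteratedDeriv k (cardinalBSpline p)
            (s - ((i : ℝ) - p))) (t / meshSize T N) := by
      intro t
      have hijr : ((i : ℕ) : ℝ) + e = (j : ℕ) + p + 1 := by exact_mod_cast hij
      rw [iteratedDeriv_splineBasis hT (by omega) (by omega),
        iteratedDeriv_splineBasis hT (by omega) (by omega), two_mul, pow_add]
      simp only
      -- The column function has index `j + 1`, hence its offset from the row function is `j + 1 - i
      -- = e - p`.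
      rw [show t / meshSize T N - (((j : ℕ) + 1 : ℕ) - (p : ℝ))
        = t / meshSize T N - ((i : ℝ) - p) - ((e : ℝ) - p) by push_cast; linarith]
      ring
    simp only [hfun]
    rw [integral_const_mul, Measure.integral_comp_div (fun s => iteratedDeriv k (cardinalBSpline p)
          (s - ((i : ℝ) - p) - ((e : ℝ) - p)) * iteratedDeriv k (cardinalBSpline p)
            (s - ((i : ℝ) - p))), integral_sub_right_eq_self (fun s =>
          iteratedDeriv k (cardinalBSpline p) (s - ((e : ℝ) - p))
            * iteratedDeriv k (cardinalBSpline p) s),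
      integral_iteratedDeriv_cardinalBSpline_mul hp hk, abs_of_pos hh, smul_eq_mul,
      show (p : ℝ) + 1 + (e - p) = e + 1 by ring]
    ring
  · intro t ht
    have hmem : t ∈ Icc (knot T N p i) (knot T N p (i + p + 1)) := by
      by_contra hc
      exact ht (by simp only [iteratedDeriv_splineBasis_eq_zero T N p i k hc, mul_zero])
    exact ⟨hpos.trans_le hmem.1, hmem.2.trans (knot_le hT (by omega) _ _)⟩

/-- The entries of the Galerkin matrices vanish where the supports do not overlap. -/
theorem galerkinMatrix_apply_of_notMem_band {T : ℝ} (hT : 0 < T) {N p : ℕ} (k : ℕ)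
    (i j : Fin (N + p - 1))
    (hij : (i : ℕ) + p + 1 ≤ (j : ℕ) + 1 ∨ (j : ℕ) + 1 + p + 1 ≤ (i : ℕ)) :
    galerkinMatrix T N p k i j = 0 := by
  -- The closed supports can still meet in one knot, which is discarded as a null set.
  have hnull : ∀ᵐ t : ℝ, t ∉ ({knot T N p i, knot T N p (j + 1)} : Set ℝ) :=
    (((Set.finite_singleton _).insert _).countable).ae_notMem volume
  refine intervalIntegral.integral_zero_ae ?_
  filter_upwards [hnull] with t ht _
  simp only [mem_insert_iff, mem_singleton_iff, not_or] at ht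
  by_contra hne
  have h1 : t ∈ Icc (knot T N p i) (knot T N p (i + p + 1)) := by
    by_contra hc
    exact hne (by rw [iteratedDeriv_splineBasis_eq_zero T N p i k hc, mul_zero])
  have h2 : t ∈ Icc (knot T N p (j + 1)) (knot T N p (j + 1 + p + 1)) := by
    by_contra hc
    exact hne (by rw [iteratedDeriv_splineBasis_eq_zero T N p (j + 1) k hc, zero_mul])
  rcases hij with h | h
  · exact ht.2 (le_antisymm (h1.2.trans (knot_mono hT N p h)) h2.1)
  · exact ht.1 (le_antisymm (h2.2.trans (knot_mono hT N p h)) h1.1)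

/-! ### Coefficients of `qPoly` and comparison with the matrices. -/

theorem kCoeff_symm (p : ℕ) (ρ δ : ℝ) {e : ℕ} (he : e ≤ 2 * p) :
    kCoeff p ρ δ (2 * p - e) = kCoeff p ρ δ e := by
  have hsymm : ∀ k, Even k → iteratedDeriv k (cardinalBSpline (2 * p + 1))
      (((2 * p - e : ℕ) : ℝ) + 1) = iteratedDeriv k (cardinalBSpline (2 * p + 1)) ((e : ℝ) + 1) := by
    intro k hk
    have h := iteratedDeriv_cardinalBSpline_symm k (2 * p) ((e : ℝ) + 1)
    rw [hk.neg_one_pow, one_mul] at h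
    rw [← h, Nat.cast_sub he]
    congr 1
    push_cast
    ring
  have h0 := hsymm 0 Even.zero
  simp only [iteratedDeriv_zero] at h0
  rw [kCoeff, kCoeff, hsymm 2 even_two, hsymm (2 * p) (even_two_mul p), h0]

theorem qPoly_eq_sum_range (p : ℕ) (ρ δ : ℝ) :
    qPoly p ρ δ = ∑ e ∈ Finset.range (2 * p + 1), C (kCoeff p ρ δ e) * X ^ e := by
  -- The partial sums fill the window of exponents from `p - q` to `p + q`, growing by one on each
  -- side.
  have key : ∀ q ≤ p, C (kCoeff p ρ δ p) * X ^ p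
      + ∑ j ∈ Finset.Icc 1 q, C (kCoeff p ρ δ (p - j)) * (X ^ (p - j) + X ^ (p + j))
      = ∑ e ∈ Finset.Ico (p - q) (p + q + 1), C (kCoeff p ρ δ e) * X ^ e := by
    intro q
    induction q with
    | zero => simp
    | succ q ih =>
      intro hq
      rw [Finset.sum_Icc_succ_top (by omega), ← add_assoc, ih (by omega),
        Finset.sum_eq_sum_Ico_succ_bot (show p - (q + 1) < p + (q + 1) + 1 by omega),
        show p - (q + 1) + 1 = p - q by omega, ← add_assoc p q 1,
        Finset.sum_Ico_succ_top (show p - q ≤ p + q + 1 by omega), ← kCoeff_symm p ρ δ (e := p + q + 1) (by omega),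
        show 2 * p - (p + q + 1) = p - (q + 1) by omega]
      ring
  rw [qPoly, key p le_rfl, Nat.sub_self, ← two_mul, Finset.range_eq_Ico]

theorem coeff_qPoly (p : ℕ) (ρ δ : ℝ) (e : ℕ) :
    (qPoly p ρ δ).coeff e = if e ≤ 2 * p then kCoeff p ρ δ e else 0 := by
  rw [qPoly_eq_sum_range, finsetSum_coeff]
  simp only [coeff_C_mul_X_pow, Finset.sum_ite_eq, Finset.mem_range, Nat.lt_succ_iff]

theorem natDegree_qPoly_le (p : ℕ) (ρ δ : ℝ) : (qPoly p ρ δ).natDegree ≤ 2 * p :=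
  natDegree_le_iff_coeff_eq_zero.2 fun e he => by rw [coeff_qPoly, if_neg (by omega)]

theorem isAssociatedPolynomial_qPoly {p : ℕ} (hp : 1 ≤ p) (ρ δ : ℝ) {T : ℝ} (hT : 0 < T) :
    IsAssociatedPolynomial p (fun N => scaledSystemMatrix T N p ρ δ) (qPoly p ρ δ) := by
  refine ⟨natDegree_qPoly_le p ρ δ, fun N i j hi hiN => ?_⟩
  have hh : meshSize T N ≠ 0 := (meshSize_pos hT (by omega)).ne'
  simp only [scaledSystemMatrix, systemMatrix, massMatrix, stiffnessMatrix, penaltyMatrix,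
    Matrix.smul_apply, Matrix.add_apply, Matrix.neg_apply, smul_eq_mul]
  by_cases hband : (i : ℕ) ≤ j + p + 1 ∧ (j : ℕ) + p + 1 - i ≤ 2 * p
  · obtain ⟨e, he⟩ := Nat.exists_eq_add_of_le hband.1
    have he2 : e ≤ 2 * p := by omega
    rw [if_pos hband.1, he, Nat.add_sub_cancel_left, coeff_qPoly, if_pos he2,
      galerkinMatrix_apply_of_mem_band hT hp (Nat.zero_le p) i j hi hiN he2 he.symm,
      galerkinMatrix_apply_of_mem_band hT hp hp i j hi hiN he2 he.symm,
      galerkinMatrix_apply_of_mem_band hT hp le_rfl i j hi hiN he2 he.symm, kCoeff]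
    simp only [mul_zero, mul_one, pow_zero, one_mul, iteratedDeriv_zero, pow_one, inv_pow]
    -- The Galerkin entries scale as `h ^ (1 - 2k)` for `k = 0, 1, p`; the weights `h * ρ / h ^ 2`,
    -- `-h` and `h * (ρ / h ^ 2) * δ * h ^ (2p)` cancel every power of `h`.
    field_simp
    ring
  · rw [galerkinMatrix_apply_of_notMem_band hT 0 i j (by omega),
      galerkinMatrix_apply_of_notMem_band hT 1 i j (by omega),
      galerkinMatrix_apply_of_notMem_band hT p i j (by omega)]
    simp only [neg_zero, mul_zero, add_zero]
    split_ifs with h1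
    · rw [coeff_qPoly, if_neg fun h2 => hband ⟨h1, h2⟩]
    · rfl

end SplineSymbol

theorem proposition5p1 (p : ℕ) (hp : 1 ≤ p) :
    -- the series converge off `0`, and the values at `0` are the continuous extensions
    (∀ θ ∈ Set.Icc (-Real.pi) Real.pi, θ ≠ 0 →
      Summable (fun j : ℤ => 1 / (θ + 2 * j * Real.pi) ^ (2 * p + 2)) ∧
      Summable (fun j : ℤ => 1 / (θ + 2 * j * Real.pi) ^ (2 * p))) ∧
    ContinuousOn (SplineSymbol.symbolM p) (Set.Icc (-Real.pi) Real.pi) ∧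
    ContinuousOn (SplineSymbol.symbolB p) (Set.Icc (-Real.pi) Real.pi) ∧
    -- the three relations
    (∀ θ ∈ Set.Icc (-Real.pi) Real.pi,
      SplineSymbol.splineSum p 0 θ = (SplineSymbol.symbolM p θ : ℂ) ∧
      SplineSymbol.splineSum p 2 θ = (SplineSymbol.symbolB p θ : ℂ) ∧
      SplineSymbol.splineSum p (2 * p) θ = (SplineSymbol.symbolD p θ : ℂ)) ∧
    -- the polynomial of the Toeplitz band part of the scaled system matrices
    ∀ ρ δ : ℝ,
      (∀ T : ℝ, 0 < T →
        SplineSymbol.IsAssociatedPolynomial p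
          (fun N => SplineSymbol.scaledSystemMatrix T N p ρ δ) (SplineSymbol.qPoly p ρ δ)) ∧
      ∀ θ ∈ Set.Icc (-Real.pi) Real.pi,
        Polynomial.aeval (Complex.exp (Complex.I * θ)) (SplineSymbol.qPoly p ρ δ) =
          Complex.exp (Complex.I * p * θ) *
            ((SplineSymbol.symbolB p θ : ℂ) + (ρ : ℂ) * ((SplineSymbol.symbolM p θ : ℂ)
              + (δ : ℂ) * (-1) ^ p * (SplineSymbol.symbolD p θ : ℂ))) := by
  refine ⟨fun θ _ _ => ⟨?_, ?_⟩, ?_, ?_, fun θ hθ => ⟨?_, ?_, ?_⟩, fun ρ δ => ⟨?_, ?_⟩⟩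
  · exact SplineSymbol.summable_one_div_add_two_mul_int_mul_pi_pow θ (by omega)
  · exact SplineSymbol.summable_one_div_add_two_mul_int_mul_pi_pow θ (by omega)
  · exact SplineSymbol.continuousOn_of_splineSum_eq fun θ hθ =>
      SplineSymbol.splineSum_zero_eq_symbolM p hθ
  · exact SplineSymbol.continuousOn_of_splineSum_eq fun θ hθ =>
      SplineSymbol.splineSum_two_eq_symbolB hp hθ
  · exact SplineSymbol.splineSum_zero_eq_symbolM p hθ
  · exact SplineSymbol.splineSum_two_eq_symbolB hp hθ
  · exact SplineSymbol.splineSum_two_mul_eq_symbolD p θ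
  · exact fun T hT => SplineSymbol.isAssociatedPolynomial_qPoly hp ρ δ hT
  · intro θ hθ
    rw [SplineSymbol.aeval_qPoly, SplineSymbol.splineSum_zero_eq_symbolM p hθ,
      SplineSymbol.splineSum_two_eq_symbolB hp hθ, SplineSymbol.splineSum_two_mul_eq_symbolD]
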